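/- Let $a,b,c,d\ge 0$ with $a+b+c+d=1$ be the coefficients of a Bell-diagonal state $a|\Phi^+\rangle\langle\Phi^+|+b|\Psi^+\rangle\langle\Psi^+|+c|\Psi^-\rangle\langle\Psi^-|+d|\Phi^-\rangle\langle\Phi^-|$ with $a+b>\tfrac12$ and $a+d>\tfrac12$ (this holds whenever $a>\tfrac12$, and for $a=\tfrac12$ if $b,d>0$). For a depolarizing parameter $\lambda$ let $f(\lambda,a,b,c,d)=(f_1,f_2,f_3)$ be the vector of the probabilities that the parities at the three measurement locations of the circuit agree. Explicitly, with $s=a+b+c+d$, $f_i=(1-\lambda)^{k_i}P_i+\bigl(1-(1-\lambda)^{k_i}\bigr)\tfrac12 s^{m_i}$, where $(k_1,k_2,k_3)=(2,2,10)$, $(m_1,m_2,m_3)=(2,2,4)$, $P_1=(a+b)^2+(c+d)^2$, $P_2=(a+d)^2+(b+c)^2$, $P_3=(A_1+B_1)(B_2+D_2)+(C_1+D_1)(A_2+C_2)$ and $A_1=a^2+d^2+ab+cd$, $B_1=b^2+c^2+ab+cd$, $C_1=ac+bd+2bc$, $D_1=ac+bd+2ad$, $A_2=a^2+b^2+ad+bc$,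 $B_2=c^2+d^2+ad+bc$, $C_2=ac+bd+2cd$, $D_2=ac+bd+2ab$. The circuit is executed repeatedly; the executions are independent and identically distributed, the parity at location $i$ agrees with probability $f_i$, and the joint law of the three parities within one execution is otherwise arbitrary. Let $p_i$ be the proportion of the first $n$ executions in which the parity at location $i$ agrees, $p=(p_1,p_2,p_3)$, and let $\Sigma$ be the covariance matrix of the three agreement indicators of one execution, i.e. $\Sigma=n\,\mathrm{Cov}(p)$. Let $\widehat a(n,\lambda)$ be the value of $a$ obtained by solving $f_i(\lambda,a,b,c,d)=p_i$ $(i=1,2,3)$, $a+b+c+d=1$ for real $a,b,c,d$ with $a+b\ge\frac12$, $a+d\ge\frac12$ (and $0$ if there is no solution). Put $U=\{x\in\mathbb R^3: x_1>\tfrac12,\ x_2>\tfrac12\}$, $s_1=\sqrt{x_1-\frac12}$, $s_2=\sqrt{x_2-\frac12}$, $q=0.9$ and $$g(x)=\frac{2000x_1x_2+2000x_1s_1s_2+1000\sqrt2\,x_1s_2-1000x_1-1000x_2-1000x_3-1000s_1s_2-500\sqrt2\,s_2+1000}{(4000\sqrt2\,x_1-2000\sqrt2)\,s_2},$$ $$g'(x)=\frac{2000\sqrt2q^6(x_1x_2+x_1s_1s_2)+2000q^7x_1s_2-1000\sqrt2q^6(x_1+x_2+s_1s_2)-1000\sqrt2x_3-1000q^7s_2+500\sqrt2(1+q^6)}{8000q^7x_1s_2-4000q^7s_2}.$$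 (1) Let $\lambda=0$ and $f=f(0,a,b,c,d)$. Then $g$ is smooth on $U$, $f\in U$, the reconstructed value of $a$ for a right-hand side $x\in U$ (in place of $p$) is $g(x)$, and for large $n$ the estimator $\widehat a(n,0)$ is approximately $\mathcal N\bigl(a,\frac1n\nabla g(f)^T\Sigma\nabla g(f)\bigr)$, that is $$\sqrt n\,\bigl(\widehat a(n,0)-a\bigr)\xrightarrow{D}\mathcal N\bigl(0,\nabla g(f)^T\Sigma\nabla g(f)\bigr)\qquad(n\to\infty),$$ where a normal law of variance $0$ is a point mass. The same holds with $g(p)$ in place of $\widehat a(n,0)$. (2) Let $\lambda=0.1$ and $f'=f(0.1,a,b,c,d)$. Then the statements of (1) hold for $\widehat a(n,0.1)$, $g'$ and $f'$ in place of $\widehat a(n,0)$, $g$ and $f$. (3) Let $\tilde g$, $\tilde g'$ be $g$, $g'$ with coefficients rounded to integers: $$\tilde g(x)=\frac{2000x_1x_2+2000x_1s_1s_2+1414x_1s_2-1000x_1-1000x_2-1000x_3-1000s_1s_2-707s_2+1000}{(5657x_1-2828)\,s_2},$$ $$\tilde g'(x)=\frac{1503x_1x_2+1503x_1s_1s_2+957x_1s_2-752x_1-752x_2-1414x_3-752s_1s_2-478s_2+1083}{3826x_1s_2-1913s_2}.$$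 Then $\tilde g,\tilde g'$ are smooth on $U$, and $\sqrt n\,(\tilde g(p)-\tilde g(f))\xrightarrow{D}\mathcal N(0,\nabla\tilde g(f)^T\Sigma\nabla\tilde g(f))$ for $\lambda=0$, and likewise with $\tilde g'$, $f'$ for $\lambda=0.1$. -/

import Mathlib

open MeasureTheory ProbabilityTheory Filter Topology
open scoped Matrix

namespace BellPair

noncomputable section

/-! ### Parity-agreement probabilities

`a, b, c, d` are the coefficients of `Φ⁺, Ψ⁺, Ψ⁻, Φ⁻` in a Bell-diagonal state; four identical copies
are fed into the circuit, which has three measurement locations. -/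

def A₁ (a b c d : ℝ) : ℝ := a ^ 2 + d ^ 2 + a * b + c * d
def B₁ (a b c d : ℝ) : ℝ := b ^ 2 + c ^ 2 + a * b + c * d
def C₁ (a b c d : ℝ) : ℝ := a * c + b * d + 2 * b * c
def D₁ (a b c d : ℝ) : ℝ := a * c + b * d + 2 * a * d
def A₂ (a b c d : ℝ) : ℝ := a ^ 2 + b ^ 2 + a * d + b * c
def B₂ (a b c d : ℝ) : ℝ := c ^ 2 + d ^ 2 + a * d + b * c
def C₂ (a b c d : ℝ) : ℝ := a * c + b * d + 2 * c * d
def D₂ (a b c d : ℝ) : ℝ := a * c + b * d + 2 * a * b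

/-- Probability of `00` or `11` at location 1, noiseless gates. -/
def agree₁ (a b c d : ℝ) : ℝ := (a + b) ^ 2 + (c + d) ^ 2

/-- Probability of `00` or `11` at location 2, noiseless gates. -/
def agree₂ (a b c d : ℝ) : ℝ := (a + d) ^ 2 + (b + c) ^ 2

/-- Probability of `00` or `11` at location 3, noiseless gates. -/
def agree₃ (a b c d : ℝ) : ℝ :=
  (A₁ a b c d + B₁ a b c d) * (B₂ a b c d + D₂ a b c d) +
    (C₁ a b c d + D₁ a b c d) * (A₂ a b c d + C₂ a b c d)

/-- The vector `(f₁, f₂, f₃)` of the probabilities of measuring `00` or `11` at the three locations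
when every gate suffers from depolarizing noise with parameter `lam`. A depolarizing error at a gate
that influences the measured parity makes this parity uniformly random; `2`, `2` and `10` gates
influence the parities at the locations 1, 2 and 3. The factors `(a + b + c + d) ^ 2` and
`(a + b + c + d) ^ 4` are `1` for a state and make the `fᵢ` homogeneous of degree `2`, `2`, `4`. -/
def agreeProb (lam a b c d : ℝ) : EuclideanSpace ℝ (Fin 3) :=
  !₂[(1 - lam) ^ 2 * agree₁ a b c d + (1 - (1 - lam) ^ 2) * ((a + b + c + d) ^ 2 / 2),
     (1 - lam) ^ 2 * agree₂ a b c d + (1 - (1 - lam) ^ 2) * ((a + b + c + d) ^ 2 / 2),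
     (1 - lam) ^ 10 * agree₃ a b c d + (1 - (1 - lam) ^ 10) * ((a + b + c + d) ^ 4 / 2)]

/-! ### State reconstruction -/

/-- `(a, b, c, d)` is a real solution of the reconstruction system
`fᵢ(lam, a, b, c, d) = xᵢ` (`i = 1, 2, 3`), `a + b + c + d = 1`, on the branch
`a + b ≥ 1 / 2`, `a + d ≥ 1 / 2`. -/
def IsReconstruction (lam : ℝ) (x : EuclideanSpace ℝ (Fin 3)) (a b c d : ℝ) : Prop :=
  agreeProb lam a b c d = x ∧ a + b + c + d = 1 ∧ 1 / 2 ≤ a + b ∧ 1 / 2 ≤ a + d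

open Classical in
/-- The value of `a` obtained by solving the reconstruction system with right-hand side `x`
(and `0` if there is no solution). -/
def reconstructA (lam : ℝ) (x : EuclideanSpace ℝ (Fin 3)) : ℝ :=
  if h : ∃ a b c d, IsReconstruction lam x a b c d then h.choose else 0

/-- The reconstruction map `g` for `lam = 0`, with exact coefficients. -/
def g (x : EuclideanSpace ℝ (Fin 3)) : ℝ :=
  (2000 * x 0 * x 1 + 2000 * x 0 * √(x 0 - 1 / 2) * √(x 1 - 1 / 2)
      + 1000 * √2 * x 0 * √(x 1 - 1 / 2) - 1000 * x 0 - 1000 * x 1 - 1000 * x 2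
      - 1000 * √(x 0 - 1 / 2) * √(x 1 - 1 / 2) - 500 * √2 * √(x 1 - 1 / 2) + 1000) /
    ((4000 * √2 * x 0 - 2000 * √2) * √(x 1 - 1 / 2))

/-- The reconstruction map `g'` for `lam = 0.1`, with exact coefficients. -/
def g' (x : EuclideanSpace ℝ (Fin 3)) : ℝ :=
  (2000 * √2 * (9 / 10) ^ 6 * x 0 * x 1
      + 2000 * √2 * (9 / 10) ^ 6 * x 0 * √(x 0 - 1 / 2) * √(x 1 - 1 / 2)
      + 2000 * (9 / 10) ^ 7 * x 0 * √(x 1 - 1 / 2)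
      - 1000 * √2 * (9 / 10) ^ 6 * x 0 - 1000 * √2 * (9 / 10) ^ 6 * x 1 - 1000 * √2 * x 2
      - 1000 * √2 * (9 / 10) ^ 6 * √(x 0 - 1 / 2) * √(x 1 - 1 / 2)
      - 1000 * (9 / 10) ^ 7 * √(x 1 - 1 / 2) + 500 * √2 * (1 + (9 / 10) ^ 6)) /
    (8000 * (9 / 10) ^ 7 * x 0 * √(x 1 - 1 / 2) - 4000 * (9 / 10) ^ 7 * √(x 1 - 1 / 2))

/-- `g` with its coefficients rounded to integers. -/
def gRounded (x : EuclideanSpace ℝ (Fin 3)) : ℝ :=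
  (2000 * x 0 * x 1 + 2000 * x 0 * √(x 0 - 1 / 2) * √(x 1 - 1 / 2)
      + 1414 * x 0 * √(x 1 - 1 / 2) - 1000 * x 0 - 1000 * x 1 - 1000 * x 2
      - 1000 * √(x 0 - 1 / 2) * √(x 1 - 1 / 2) - 707 * √(x 1 - 1 / 2) + 1000) /
    ((5657 * x 0 - 2828) * √(x 1 - 1 / 2))

/-- `g'` with its coefficients rounded to integers. -/
def gRounded' (x : EuclideanSpace ℝ (Fin 3)) : ℝ :=
  (1503 * x 0 * x 1 + 1503 * x 0 * √(x 0 - 1 / 2) * √(x 1 - 1 / 2)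
      + 957 * x 0 * √(x 1 - 1 / 2) - 752 * x 0 - 752 * x 1 - 1414 * x 2
      - 752 * √(x 0 - 1 / 2) * √(x 1 - 1 / 2) - 478 * √(x 1 - 1 / 2) + 1083) /
    (3826 * x 0 * √(x 1 - 1 / 2) - 1913 * √(x 1 - 1 / 2))

/-- The region on which the reconstruction maps are smooth. -/
def U : Set (EuclideanSpace ℝ (Fin 3)) := {x | 1 / 2 < x 0 ∧ 1 / 2 < x 1}

/-! ### The random experiment -/

variable {Ω : Type*} [MeasurableSpace Ω]

/-- `ξ k ω i` tells whether the parity agrees (outcome `00` or `11`) at location `i` in the `k`-th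
execution of the circuit. The executions are independent and identically distributed, and the parity
at location `i` agrees with probability `q i`; the joint law of the three parities of one execution
is otherwise arbitrary. -/
structure CircuitRuns (P : Measure Ω) (q : EuclideanSpace ℝ (Fin 3))
    (ξ : ℕ → Ω → Fin 3 → Bool) : Prop where
  measurable : ∀ k, Measurable (ξ k)
  indep : iIndepFun ξ P
  ident : ∀ k, IdentDistrib (ξ k) (ξ 0) P P
  marginal : ∀ i, P.real {ω | ξ 0 ω i = true} = q i

/-- The random vector `p = (p₁, p₂, p₃)` of the proportions of agreeing parities among the first `n`
executions. -/
def proportion (ξ : ℕ → Ω → Fin 3 → Bool) (n : ℕ) (ω : Ω) : EuclideanSpace ℝ (Fin 3) :=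
  WithLp.toLp 2 fun i => (((Finset.range n).filter fun k => ξ k ω i = true).card : ℝ) / n

/-- The covariance matrix of the parity-agreement indicators of one execution, that is `n` times the
covariance matrix of `proportion ξ n`. -/
def covMatrix (P : Measure Ω) (ξ : ℕ → Ω → Fin 3 → Bool) : Matrix (Fin 3) (Fin 3) ℝ :=
  Matrix.of fun i j =>
    cov[fun ω => if ξ 0 ω i = true then (1 : ℝ) else 0,
        fun ω => if ξ 0 ω j = true then (1 : ℝ) else 0; P]

/-- `∇h(q)ᵀ S ∇h(q)`. -/
def deltaVariance (h : EuclideanSpace ℝ (Fin 3) → ℝ) (q : EuclideanSpace ℝ (Fin 3))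
    (S : Matrix (Fin 3) (Fin 3) ℝ) : ℝ :=
  (gradient h q).ofLp ⬝ᵥ (S *ᵥ (gradient h q).ofLp)

/-- For large `n`, `T n` is approximately `𝒩(m, v / n)`: the variables `√n (T n - m)` converge in
distribution to `𝒩(0, v)` (the point mass at `0` if `v = 0`). -/
def AsymptoticallyNormal (P : Measure Ω) [IsProbabilityMeasure P] (T : ℕ → Ω → ℝ) (m v : ℝ) :
    Prop :=
  0 ≤ v ∧ TendstoInDistribution (fun (n : ℕ) ω => √(n : ℝ) * (T n ω - m)) atTop id (fun _ => P)
    (gaussianReal 0 v.toNNReal)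

end

end BellPair

open BellPair

namespace BellPair

/-! ### Solving the reconstruction system -/

/-! Put `u = a + b - 1/2`, `v = a + d - 1/2` and `q = 1 - lam`. Under `a + b + c + d = 1` the first
two equations fix `u ^ 2` and `v ^ 2`, and the third is affine in `a` with slope `-16 * q ^ 10 * u ^
2 * v`. On the branch `u, v ≥ 0` a right-hand side in `U` therefore determines `u`, `v` by square
roots and then `a` by a division; the result is `solveA q`, of which `g` and `g'` are the cases `q =
1` and `q = 9/10`. Since `U` is open and contains the true probability vector, the estimator
coincides near that vector with a smooth function.

The rest is the delta method (`CircuitRuns.asymptoticallyNormal`). The first-order term is a fixed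
linear form in the proportions, so the scalar central limit theorem suffices. Chebyshev's inequality
shows that the Taylor remainder times `√n` tends to `0` in probability. The rounded maps only need
differentiability. -/

lemma agree₁_eq {a b c d : ℝ} (h : a + b + c + d = 1) :
    agree₁ a b c d = 1 / 2 + 2 * (a + b - 1 / 2) ^ 2 := by
  obtain rfl : c = 1 - a - b - d := by linarith
  unfold agree₁
  ring

lemma agree₂_eq {a b c d : ℝ} (h : a + b + c + d = 1) :
    agree₂ a b c d = 1 / 2 + 2 * (a + d - 1 / 2) ^ 2 := by
  obtain rfl : c = 1 - a - b - d := by linarith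
  unfold agree₂
  ring

/-- In terms of `u = a + b - 1 / 2` and `v = a + d - 1 / 2`, the third agreement probability is
affine in `a`. -/
lemma agree₃_eq {a b c d : ℝ} (h : a + b + c + d = 1) :
    agree₃ a b c d = 1 / 2 + 4 * (a + b - 1 / 2) ^ 2 * (a + d - 1 / 2) *
      (2 * (a + b - 1 / 2) + 2 * (a + d - 1 / 2) + 1 - 4 * a) := by
  obtain rfl : c = 1 - a - b - d := by linarith
  unfold agree₃ A₁ A₂ B₁ B₂ C₁ C₂ D₁ D₂
  ring

lemma agreeProb_apply_zero {lam a b c d : ℝ} (h : a + b + c + d = 1) :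
    agreeProb lam a b c d 0 = 1 / 2 + (1 - lam) ^ 2 * (2 * (a + b - 1 / 2) ^ 2) := by
  simp [agreeProb, agree₁_eq h, h]
  ring

lemma agreeProb_apply_one {lam a b c d : ℝ} (h : a + b + c + d = 1) :
    agreeProb lam a b c d 1 = 1 / 2 + (1 - lam) ^ 2 * (2 * (a + d - 1 / 2) ^ 2) := by
  simp [agreeProb, agree₂_eq h, h]
  ring

lemma agreeProb_apply_two {lam a b c d : ℝ} (h : a + b + c + d = 1) :
    agreeProb lam a b c d 2 = 1 / 2 + (1 - lam) ^ 10 * (4 * (a + b - 1 / 2) ^ 2 *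
      (a + d - 1 / 2) * (2 * (a + b - 1 / 2) + 2 * (a + d - 1 / 2) + 1 - 4 * a)) := by
  simp [agreeProb, agree₃_eq h, h]
  ring

lemma agreeProb_mem_U {lam a b c d : ℝ} (hlam : lam < 1) (h : a + b + c + d = 1)
    (hab : 1 / 2 < a + b) (had : 1 / 2 < a + d) : agreeProb lam a b c d ∈ U := by
  have hq : 0 < 1 - lam := by linarith
  have hu : 0 < a + b - 1 / 2 := by linarith
  have hv : 0 < a + d - 1 / 2 := by linarith
  refine ⟨?_, ?_⟩
  · rw [agreeProb_apply_zero h]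
    exact lt_add_of_pos_right _ (by positivity)
  · rw [agreeProb_apply_one h]
    exact lt_add_of_pos_right _ (by positivity)

/-- The solution `a` of the reconstruction system whose gates are noiseless with
probability `q`. -/
noncomputable def solveA (q : ℝ) (x : EuclideanSpace ℝ (Fin 3)) : ℝ :=
  (√2 * (√(x 0 - 1 / 2) + √(x 1 - 1 / 2)) / q + 1) / 4 -
    √2 * (x 2 - 1 / 2) / (8 * q ^ 7 * (x 0 - 1 / 2) * √(x 1 - 1 / 2))

lemma sqrt_two_mul_sq_div {q s : ℝ} :
    q ^ 2 * (2 * (√2 * s / (2 * q)) ^ 2) = (q * q⁻¹) ^ 2 * s ^ 2 := by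
  have h2 : √2 ^ 2 = 2 := Real.sq_sqrt (by norm_num)
  rw [div_pow, mul_pow, h2]
  ring

lemma IsReconstruction.eq_solveA {lam a b c d : ℝ} {x : EuclideanSpace ℝ (Fin 3)} (hlam : lam < 1)
    (hx : x ∈ U) (h : IsReconstruction lam x a b c d) : a = solveA (1 - lam) x := by
  obtain ⟨rfl, hsum, hab, had⟩ := h
  obtain ⟨hx0, hx1⟩ := hx
  have hq : 0 < 1 - lam := by linarith
  rw [solveA, agreeProb_apply_zero hsum, agreeProb_apply_one hsum, agreeProb_apply_two hsum]
  rw [agreeProb_apply_zero hsum] at hx0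
  rw [agreeProb_apply_one hsum] at hx1
  obtain ⟨u, hu⟩ : ∃ u, u = a + b - 1 / 2 := ⟨_, rfl⟩
  obtain ⟨v, hv⟩ : ∃ v, v = a + d - 1 / 2 := ⟨_, rfl⟩
  generalize 1 - lam = q at *
  rw [← hu] at hx0 ⊢
  rw [← hv] at hx1 ⊢
  -- The branch condition only gives `u ≥ 0`; `u = 0` would put the first coordinate at `1 / 2`,
  -- outside `U`. The same goes for `v`.
  have hu0 : 0 < u := by
    refine lt_of_le_of_ne (by linarith) fun h0 => ?_
    rw [← h0] at hx0
    norm_num at hx0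
  have hv0 : 0 < v := by
    refine lt_of_le_of_ne (by linarith) fun h0 => ?_
    rw [← h0] at hx1
    norm_num at hx1
  have h2 : √2 ^ 2 = 2 := Real.sq_sqrt (by norm_num)
  have hs2 : 0 < √2 := by positivity
  have hs : ∀ w, 0 < w → √(1 / 2 + q ^ 2 * (2 * w ^ 2) - 1 / 2) = q * √2 * w := fun w hw => by
    rw [show 1 / 2 + q ^ 2 * (2 * w ^ 2) - 1 / 2 = (q * √2 * w) ^ 2 by
      rw [mul_pow, mul_pow, h2]; ring]
    exact Real.sqrt_sq (by positivity)
  rw [hs u hu0, hs v hv0, add_sub_cancel_left, add_sub_cancel_left]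
  have e1 : √2 * (q * √2 * u + q * √2 * v) / q = 2 * (u + v) := by
    rw [div_eq_iff hq.ne']
    linear_combination (q * u + q * v) * h2
  rw [e1]
  field_simp
  ring

/-- The unknowns are arbitrary reals, with no sign condition, so the three equations can be solved
one after another. Hence the default value `0` of `reconstructA` never occurs on `U`. -/
lemma exists_isReconstruction {lam : ℝ} {x : EuclideanSpace ℝ (Fin 3)} (hlam : lam < 1)
    (hx : x ∈ U) : ∃ a b c d, IsReconstruction lam x a b c d := by
  obtain ⟨hx0, hx1⟩ := hx
  have hq : 0 < 1 - lam := by linarith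
  have h2 : √2 ^ 2 = 2 := Real.sq_sqrt (by norm_num)
  have hs : 0 < √(x 0 - 1 / 2) := Real.sqrt_pos.2 (by linarith)
  have ht : 0 < √(x 1 - 1 / 2) := Real.sqrt_pos.2 (by linarith)
  have hs2 : √(x 0 - 1 / 2) ^ 2 = x 0 - 1 / 2 := Real.sq_sqrt (by linarith)
  have ht2 : √(x 1 - 1 / 2) ^ 2 = x 1 - 1 / 2 := Real.sq_sqrt (by linarith)
  have hu : 0 < √2 * √(x 0 - 1 / 2) / (2 * (1 - lam)) := by positivity
  have hv : 0 < √2 * √(x 1 - 1 / 2) / (2 * (1 - lam)) := by positivity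
  obtain ⟨u, hu'⟩ : ∃ u, u = √2 * √(x 0 - 1 / 2) / (2 * (1 - lam)) := ⟨_, rfl⟩
  obtain ⟨v, hv'⟩ : ∃ v, v = √2 * √(x 1 - 1 / 2) / (2 * (1 - lam)) := ⟨_, rfl⟩
  have hsq : ∀ w s : ℝ, w = √2 * s / (2 * (1 - lam)) → (1 - lam) ^ 2 * (2 * w ^ 2) = s ^ 2 := by
    rintro w s rfl
    rw [sqrt_two_mul_sq_div, mul_inv_cancel₀ hq.ne', one_pow, one_mul]
  have hu2 := hsq _ _ hu'
  have hv2 := hsq _ _ hv'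
  rw [← hu'] at hu
  rw [← hv'] at hv
  -- The root of the third equation, which is affine in `a` with nonzero slope because `u, v > 0`.
  obtain ⟨a, ha⟩ : ∃ a, a =
    (2 * u + 2 * v + 1) / 4 - (x 2 - 1 / 2) / (16 * (1 - lam) ^ 10 * u ^ 2 * v) := ⟨_, rfl⟩
  have hsum : a + (u + 1 / 2 - a) + (a - u - v) + (v + 1 / 2 - a) = 1 := by ring
  refine ⟨a, u + 1 / 2 - a, a - u - v, v + 1 / 2 - a, ?_, hsum, by linarith, by linarith⟩
  have eu : a + (u + 1 / 2 - a) - 1 / 2 = u := by ring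
  have ev : a + (v + 1 / 2 - a) - 1 / 2 = v := by ring
  ext i
  fin_cases i
  · simp only [Fin.zero_eta]
    rw [agreeProb_apply_zero hsum, eu, hu2, hs2]
    ring
  · simp only [Fin.mk_one]
    rw [agreeProb_apply_one hsum, ev, hv2, ht2]
    ring
  · simp only [Fin.reduceFinMk]
    rw [agreeProb_apply_two hsum, eu, ev, ha]
    field_simp
    ring

lemma reconstructA_eq_solveA {lam : ℝ} {x : EuclideanSpace ℝ (Fin 3)} (hlam : lam < 1)
    (hx : x ∈ U) : reconstructA lam x = solveA (1 - lam) x := by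
  have h := exists_isReconstruction hlam hx
  rw [reconstructA, dif_pos h]
  obtain ⟨b, c, d, hr⟩ := h.choose_spec
  exact hr.eq_solveA hlam hx

lemma g_eq_solveA {x : EuclideanSpace ℝ (Fin 3)} (hx : x ∈ U) : g x = solveA 1 x := by
  obtain ⟨hx0, hx1⟩ := hx
  have hs : 0 < √(x 0 - 1 / 2) := Real.sqrt_pos.2 (by linarith)
  have ht : 0 < √(x 1 - 1 / 2) := Real.sqrt_pos.2 (by linarith)
  have hs2 : x 0 = √(x 0 - 1 / 2) ^ 2 + 1 / 2 := by rw [Real.sq_sqrt (by linarith)]; ring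
  have ht2 : x 1 = √(x 1 - 1 / 2) ^ 2 + 1 / 2 := by rw [Real.sq_sqrt (by linarith)]; ring
  have h2 : √2 ^ 2 = 2 := Real.sq_sqrt (by norm_num)
  have h20 : 0 < √2 := by positivity
  unfold g solveA
  -- In the variables `s`, `t` both sides are rational functions; they agree modulo `√2 ^ 2 = 2`.
  generalize √(x 0 - 1 / 2) = s at *
  generalize √(x 1 - 1 / 2) = t at *
  rw [hs2, ht2, show (4000 * √2 * (s ^ 2 + 1 / 2) - 2000 * √2) * t = 4000 * √2 * s ^ 2 * t by ring,
    add_sub_cancel_right]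
  field_simp
  linear_combination (-(8000 * (16 * s ^ 2 * t * (s + t) - 4 * (2 * x 2 - 1)))) * h2

lemma g'_eq_solveA {x : EuclideanSpace ℝ (Fin 3)} (hx : x ∈ U) : g' x = solveA (9 / 10) x := by
  obtain ⟨hx0, hx1⟩ := hx
  have hs : 0 < √(x 0 - 1 / 2) := Real.sqrt_pos.2 (by linarith)
  have ht : 0 < √(x 1 - 1 / 2) := Real.sqrt_pos.2 (by linarith)
  have hs2 : x 0 = √(x 0 - 1 / 2) ^ 2 + 1 / 2 := by rw [Real.sq_sqrt (by linarith)]; ring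
  have ht2 : x 1 = √(x 1 - 1 / 2) ^ 2 + 1 / 2 := by rw [Real.sq_sqrt (by linarith)]; ring
  have hq : (0 : ℝ) < 9 / 10 := by norm_num
  unfold g' solveA
  generalize √(x 0 - 1 / 2) = s at *
  generalize √(x 1 - 1 / 2) = t at *
  -- The identity holds for every `q > 0`, so the powers of `9 / 10` can stay symbolic.
  generalize (9 / 10 : ℝ) = q at *
  rw [hs2, ht2, show 8000 * q ^ 7 * (s ^ 2 + 1 / 2) * t - 4000 * q ^ 7 * t =
    8000 * q ^ 7 * s ^ 2 * t by ring, add_sub_cancel_right]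
  field_simp
  ring

/-! ### Smoothness -/

lemma isOpen_U : IsOpen U := by
  have h (i : Fin 3) : Continuous fun x : EuclideanSpace ℝ (Fin 3) => x i := by fun_prop
  exact (isOpen_lt continuous_const (h 0)).inter (isOpen_lt continuous_const (h 1))

lemma contDiffOn_sqrt_sub_half {i : Fin 3} (hi : ∀ x ∈ U, 1 / 2 < x i) :
    ContDiffOn ℝ (⊤ : ℕ∞) (fun x : EuclideanSpace ℝ (Fin 3) => √(x i - 1 / 2)) U :=
  ContDiffOn.sqrt (by fun_prop) fun x hx => (sub_pos.2 (hi x hx)).ne'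

lemma contDiffOn_sqrt_zero :
    ContDiffOn ℝ (⊤ : ℕ∞) (fun x : EuclideanSpace ℝ (Fin 3) => √(x 0 - 1 / 2)) U :=
  contDiffOn_sqrt_sub_half fun _ hx => hx.1

lemma contDiffOn_sqrt_one :
    ContDiffOn ℝ (⊤ : ℕ∞) (fun x : EuclideanSpace ℝ (Fin 3) => √(x 1 - 1 / 2)) U :=
  contDiffOn_sqrt_sub_half fun _ hx => hx.2

lemma contDiffOn_solveA {q : ℝ} (hq : q ≠ 0) : ContDiffOn ℝ (⊤ : ℕ∞) (solveA q) U := by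
  have h0 := contDiffOn_sqrt_zero
  have h1 := contDiffOn_sqrt_one
  unfold solveA
  refine ContDiffOn.sub (by fun_prop) (ContDiffOn.div (by fun_prop) (by fun_prop) fun x hx => ?_)
  have hx0 : x 0 - 1 / 2 ≠ 0 := (sub_pos.2 hx.1).ne'
  have hx1 : √(x 1 - 1 / 2) ≠ 0 := (Real.sqrt_pos.2 (sub_pos.2 hx.2)).ne'
  positivity

lemma contDiffOn_g : ContDiffOn ℝ (⊤ : ℕ∞) g U :=
  (contDiffOn_solveA one_ne_zero).congr fun _ => g_eq_solveA

lemma contDiffOn_g' : ContDiffOn ℝ (⊤ : ℕ∞) g' U :=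
  (contDiffOn_solveA (by norm_num)).congr fun _ => g'_eq_solveA

lemma contDiffOn_gRounded : ContDiffOn ℝ (⊤ : ℕ∞) gRounded U := by
  have h0 := contDiffOn_sqrt_zero
  have h1 := contDiffOn_sqrt_one
  unfold gRounded
  refine ContDiffOn.div (by fun_prop) (by fun_prop) fun x hx => mul_ne_zero ?_ ?_
  · have := hx.1
    linarith
  · exact (Real.sqrt_pos.2 (sub_pos.2 hx.2)).ne'

lemma contDiffOn_gRounded' : ContDiffOn ℝ (⊤ : ℕ∞) gRounded' U := by
  have h0 := contDiffOn_sqrt_zero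
  have h1 := contDiffOn_sqrt_one
  unfold gRounded'
  refine ContDiffOn.div (by fun_prop) (by fun_prop) fun x hx => ?_
  rw [show 3826 * x 0 * √(x 1 - 1 / 2) - 1913 * √(x 1 - 1 / 2) =
    3826 * (x 0 - 1 / 2) * √(x 1 - 1 / 2) by ring]
  exact mul_ne_zero (mul_ne_zero (by norm_num) (sub_pos.2 hx.1).ne')
    (Real.sqrt_pos.2 (sub_pos.2 hx.2)).ne'

end BellPair

namespace BellPair

/-! ### The delta method -/

/-- The indicator of agreement at location `i`, as a function of the outcome of one execution. -/
def agreeInd (i : Fin 3) (z : Fin 3 → Bool) : ℝ := if z i = true then 1 else 0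

lemma proportion_apply {Ω : Type*} {ξ : ℕ → Ω → Fin 3 → Bool} (n : ℕ) (ω : Ω) (i : Fin 3) :
    proportion ξ n ω i = (∑ k ∈ Finset.range n, agreeInd i (ξ k ω)) / n := by
  simp [proportion, agreeInd]

variable {Ω : Type*} [MeasurableSpace Ω] {P : Measure Ω} {q : EuclideanSpace ℝ (Fin 3)}
  {ξ : ℕ → Ω → Fin 3 → Bool}

/-- No regularity of `f` is needed: the first `n` executions take values in a finite space, on which
every function is measurable. This covers `reconstructA`, which is defined by choice. -/
lemma CircuitRuns.measurable_comp_proportion (h : CircuitRuns P q ξ)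
    (f : EuclideanSpace ℝ (Fin 3) → ℝ) (n : ℕ) : Measurable fun ω => f (proportion ξ n ω) := by
  have h1 : Measurable fun ω (k : Fin n) => ξ k ω := measurable_pi_lambda _ fun k => h.measurable k
  let F : (Fin n → Fin 3 → Bool) → ℝ := fun z =>
    f (WithLp.toLp 2 fun i => (∑ k, agreeInd i (z k)) / n)
  have h2 : (fun ω => f (proportion ξ n ω)) = F ∘ fun ω (k : Fin n) => ξ k ω := by
    ext ω
    simp only [F, Function.comp_apply]
    congr 1
    ext i
    rw [proportion_apply, Finset.sum_range]
  rw [h2]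
  exact (measurable_of_finite F).comp h1

lemma CircuitRuns.memLp_comp [IsFiniteMeasure P] (h : CircuitRuns P q ξ) (f : (Fin 3 → Bool) → ℝ)
    (k : ℕ) : MemLp (fun ω => f (ξ k ω)) 2 P := by
  obtain ⟨C, hC⟩ := (Set.finite_range fun z => ‖f z‖).bddAbove
  exact MemLp.of_bound ((measurable_of_finite f).comp (h.measurable k)).aestronglyMeasurable C
    (ae_of_all _ fun ω => hC ⟨_, rfl⟩)

lemma CircuitRuns.iIndepFun_comp (h : CircuitRuns P q ξ) (f : (Fin 3 → Bool) → ℝ) :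
    iIndepFun (fun k ω => f (ξ k ω)) P :=
  h.indep.comp (fun _ => f) fun _ => measurable_of_finite f

lemma CircuitRuns.identDistrib_comp (h : CircuitRuns P q ξ) (f : (Fin 3 → Bool) → ℝ) (k : ℕ) :
    IdentDistrib (fun ω => f (ξ k ω)) (fun ω => f (ξ 0 ω)) P P :=
  (h.ident k).comp (measurable_of_finite f)

lemma CircuitRuns.integral_agreeInd (h : CircuitRuns P q ξ) (i : Fin 3) :
    ∫ ω, agreeInd i (ξ 0 ω) ∂P = q i := by
  have hm : MeasurableSet {ω | ξ 0 ω i = true} :=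
    (measurable_pi_apply i).comp (h.measurable 0) (measurableSet_singleton true)
  rw [← h.marginal i, ← integral_indicator_one hm]
  congr 1 with ω
  simp [agreeInd, Set.indicator_apply]

lemma CircuitRuns.integral_linear [IsFiniteMeasure P] (h : CircuitRuns P q ξ) (w : Fin 3 → ℝ) :
    ∫ ω, ∑ i, w i * agreeInd i (ξ 0 ω) ∂P = ∑ i, w i * q i := by
  rw [integral_finsetSum _ fun i _ =>
    ((h.memLp_comp (agreeInd i) 0).integrable (by norm_num)).const_mul _]
  simp_rw [integral_const_mul, h.integral_agreeInd]

lemma CircuitRuns.variance_linear [IsFiniteMeasure P] (h : CircuitRuns P q ξ) (w : Fin 3 → ℝ) :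
    Var[fun ω => ∑ i, w i * agreeInd i (ξ 0 ω); P] = w ⬝ᵥ (covMatrix P ξ *ᵥ w) := by
  rw [variance_fun_sum fun i => (h.memLp_comp (agreeInd i) 0).const_mul (w i)]
  simp_rw [covariance_const_mul_left, covariance_const_mul_right]
  simp only [dotProduct, Matrix.mulVec, Finset.mul_sum, covMatrix, Matrix.of_apply]
  refine Finset.sum_congr rfl fun i _ => Finset.sum_congr rfl fun j _ => ?_
  simp only [agreeInd]
  ring

/-- The central limit theorem for the linear statistic `∑ i, w i * pᵢ`. -/
lemma CircuitRuns.tendstoInDistribution_linear [IsProbabilityMeasure P] (h : CircuitRuns P q ξ)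
    (w : Fin 3 → ℝ) :
    TendstoInDistribution
      (fun (n : ℕ) ω => √(n : ℝ) * ∑ i, w i * (proportion ξ n ω i - q i)) atTop id (fun _ => P)
      (gaussianReal 0 (w ⬝ᵥ (covMatrix P ξ *ᵥ w)).toNNReal) := by
  rw [← h.variance_linear w]
  let f : (Fin 3 → Bool) → ℝ := fun z => ∑ i, w i * agreeInd i z
  have key := tendstoInDistribution_inv_sqrt_mul_sum_sub (P := P) (X := fun k ω => f (ξ k ω))
    (Y := id) (P' := gaussianReal 0 Var[fun ω => f (ξ 0 ω); P].toNNReal)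
    HasLaw.id (h.memLp_comp f 0) (h.iIndepFun_comp f) (h.identDistrib_comp f)
  convert! key using 3 with n ω
  rw [h.integral_linear w]
  rcases Nat.eq_zero_or_pos n with rfl | hn
  · simp
  have hn' : (0 : ℝ) < n := by exact_mod_cast hn
  have hs : (√(n : ℝ))⁻¹ * n = √n := by
    rw [inv_mul_eq_div, Real.div_sqrt]
  have e : ∑ k ∈ Finset.range n, f (ξ k ω) - n * ∑ i, w i * q i =
      n * ∑ i, w i * (proportion ξ n ω i - q i) := by
    simp only [f]
    rw [Finset.sum_comm, Finset.mul_sum, Finset.mul_sum, ← Finset.sum_sub_distrib]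
    refine Finset.sum_congr rfl fun i _ => ?_
    rw [proportion_apply, ← Finset.mul_sum]
    field_simp
  rw [e, ← mul_assoc, hs]

/-- Chebyshev's inequality for the number of agreements, with each indicator's variance bounded
crudely by `1`. -/
lemma CircuitRuns.measureReal_abs_proportion_sub_le [IsProbabilityMeasure P]
    (h : CircuitRuns P q ξ) (i : Fin 3) {n : ℕ} (hn : 0 < n) {r : ℝ} (hr : 0 < r) :
    P.real {ω | r ≤ |proportion ξ n ω i - q i|} ≤ 1 / (n * r ^ 2) := by
  have hn' : (0 : ℝ) < n := by exact_mod_cast hn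
  have hmem : ∀ k, MemLp (fun ω => agreeInd i (ξ k ω)) 2 P := h.memLp_comp (agreeInd i)
  let S : Ω → ℝ := ∑ k ∈ Finset.range n, fun ω => agreeInd i (ξ k ω)
  have hS : MemLp S 2 P := memLp_finsetSum' _ fun k _ => hmem k
  have hmean : P[S] = n * q i := by
    simp only [S, Finset.sum_apply]
    rw [integral_finsetSum _ fun k _ => (hmem k).integrable (by norm_num)]
    simp_rw [(h.identDistrib_comp (agreeInd i) _).integral_eq, h.integral_agreeInd]
    simp
  have hvar : Var[S; P] ≤ n := by
    rw [IndepFun.variance_sum (fun k _ => hmem k)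
      fun k _ l _ hkl => (h.iIndepFun_comp (agreeInd i)).indepFun hkl]
    calc ∑ k ∈ Finset.range n, Var[fun ω => agreeInd i (ξ k ω); P]
        ≤ ∑ k ∈ Finset.range n, (1 : ℝ) := by
          refine Finset.sum_le_sum fun k _ => ?_
          refine (variance_le_sq_of_bounded (a := 0) (b := 1) (ae_of_all _ fun ω => ?_)
            (hmem k).aemeasurable).trans (by norm_num)
          simp only [agreeInd]
          split_ifs <;> simp
      _ = n := by simp
  have hsub : {ω | r ≤ |proportion ξ n ω i - q i|} = {ω | n * r ≤ |S ω - P[S]|} := by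
    ext ω
    simp only [Set.mem_ofPred_eq]
    have : S ω - P[S] = n * (proportion ξ n ω i - q i) := by
      rw [hmean, proportion_apply]
      simp only [S, Finset.sum_apply]
      field_simp
    rw [this, abs_mul, abs_of_pos hn', mul_le_mul_iff_right₀ hn']
  rw [hsub]
  refine (ENNReal.toReal_mono ENNReal.ofReal_ne_top
    (meas_ge_le_variance_div_sq hS (mul_pos hn' hr))).trans ?_
  rw [ENNReal.toReal_ofReal (div_nonneg (variance_nonneg _ _) (by positivity)),
    div_le_div_iff₀ (by positivity) (by positivity), one_mul, mul_pow]
  calc Var[S; P] * (n * r ^ 2) ≤ n * (n * r ^ 2) := by gcongr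
    _ = n ^ 2 * r ^ 2 := by ring

/-- If all three coordinates deviate by less than `r / 2`, the squared norm is below `3 * r ^ 2 /
4`. A union bound then gives `12 = 3 * 4`. -/
lemma CircuitRuns.measureReal_norm_proportion_sub_le [IsProbabilityMeasure P]
    (h : CircuitRuns P q ξ) {n : ℕ} (hn : 0 < n) {r : ℝ} (hr : 0 < r) :
    P.real {ω | r ≤ ‖proportion ξ n ω - q‖} ≤ 12 / (n * r ^ 2) := by
  have hsub : {ω | r ≤ ‖proportion ξ n ω - q‖} ⊆
      ⋃ i, {ω | r / 2 ≤ |proportion ξ n ω i - q i|} := by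
    intro ω hω
    by_contra hcon
    simp only [Set.mem_iUnion, Set.mem_ofPred_eq, not_exists, not_le] at hcon hω
    have hsq : r ^ 2 ≤ ‖proportion ξ n ω - q‖ ^ 2 := by gcongr
    rw [EuclideanSpace.norm_sq_eq, Fin.sum_univ_three] at hsq
    have hlt : ∀ i, ‖(proportion ξ n ω - q) i‖ ^ 2 < (r / 2) ^ 2 := fun i =>
      pow_lt_pow_left₀ (hcon i) (abs_nonneg _) two_ne_zero
    nlinarith [hlt 0, hlt 1, hlt 2]
  refine (measureReal_mono hsub).trans ((measureReal_iUnion_fintype_le _).trans ?_)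
  refine (Finset.sum_le_sum fun i _ =>
    h.measureReal_abs_proportion_sub_le i hn (half_pos hr)).trans (le_of_eq ?_)
  have hn' : (0 : ℝ) < n := by exact_mod_cast hn
  rw [Fin.sum_univ_three]
  field_simp
  norm_num

/-- A function which is `o(x - q)` is negligible at the scale `1 / √n` along the proportions. -/
lemma CircuitRuns.tendstoInMeasure_of_isLittleO [IsProbabilityMeasure P] (h : CircuitRuns P q ξ)
    {R : EuclideanSpace ℝ (Fin 3) → ℝ} (hR : R =o[𝓝 q] fun x => x - q) :
    TendstoInMeasure P (fun (n : ℕ) ω => √(n : ℝ) * R (proportion ξ n ω)) atTop 0 := by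
  rw [tendstoInMeasure_iff_measureReal_norm]
  intro ε hε
  simp only [Pi.zero_apply, sub_zero]
  rw [Metric.tendsto_atTop]
  intro δ hδ
  -- `12 * η ^ 2 / ε ^ 2` is the deviation bound at radius `ε / (√n * η)`; it does not depend on
  -- `n`.
  obtain ⟨η, hη, hηδ⟩ : ∃ η : ℝ, 0 < η ∧ 12 * η ^ 2 / ε ^ 2 < δ / 2 := by
    have hcont : Tendsto (fun η : ℝ => 12 * η ^ 2 / ε ^ 2) (𝓝[>] 0) (𝓝 (12 * 0 ^ 2 / ε ^ 2)) :=
      ((by fun_prop : Continuous fun η : ℝ => 12 * η ^ 2 / ε ^ 2).tendsto 0).mono_left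
        nhdsWithin_le_nhds
    obtain ⟨η, h1, h2⟩ := ((hcont.eventually_lt_const
      (by simpa using half_pos hδ : 12 * 0 ^ 2 / ε ^ 2 < δ / 2)).and
        self_mem_nhdsWithin).exists
    exact ⟨η, h2, h1⟩
  obtain ⟨ρ, hρ, hball⟩ := Metric.eventually_nhds_iff.1 (hR.def hη)
  have hlim : Tendsto (fun n : ℕ => 12 / ρ ^ 2 / (n : ℝ)) atTop (𝓝 0) :=
    tendsto_const_div_atTop_nhds_zero_nat _
  obtain ⟨N, hN⟩ := eventually_atTop.1 (hlim.eventually_lt_const (half_pos hδ))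
  refine ⟨max N 1, fun n hn => ?_⟩
  have hn0 : 0 < n := (le_max_right N 1).trans hn
  have hn' : (0 : ℝ) < n := by exact_mod_cast hn0
  have hsn : 0 < √(n : ℝ) := Real.sqrt_pos.2 hn'
  -- Either the proportions leave the ball where `‖R x‖ ≤ η * ‖x - q‖`, or this bound forces a
  -- deviation of order `1 / √n`.
  have hsub : {ω | ε ≤ ‖√(n : ℝ) * R (proportion ξ n ω)‖} ⊆
      {ω | ρ ≤ ‖proportion ξ n ω - q‖} ∪ {ω | ε / (√n * η) ≤ ‖proportion ξ n ω - q‖} := by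
    intro ω hω
    by_cases hlt : ρ ≤ ‖proportion ξ n ω - q‖
    · exact Or.inl hlt
    · right
      have hb := hball (y := proportion ξ n ω) (by rw [dist_eq_norm]; exact not_le.1 hlt)
      simp only [Set.mem_ofPred_eq, norm_mul, Real.norm_of_nonneg hsn.le] at hω ⊢
      rw [div_le_iff₀ (by positivity)]
      calc ε ≤ √n * ‖R (proportion ξ n ω)‖ := hω
        _ ≤ √n * (η * ‖proportion ξ n ω - q‖) := by gcongr
        _ = ‖proportion ξ n ω - q‖ * (√n * η) := by ring
  rw [Real.dist_0_eq_abs, abs_of_nonneg measureReal_nonneg]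
  calc P.real {ω | ε ≤ ‖√(n : ℝ) * R (proportion ξ n ω)‖}
      ≤ 12 / (n * ρ ^ 2) + 12 / (n * (ε / (√n * η)) ^ 2) :=
        (measureReal_mono hsub).trans ((measureReal_union_le _ _).trans (add_le_add
          (h.measureReal_norm_proportion_sub_le hn0 hρ)
          (h.measureReal_norm_proportion_sub_le hn0 (by positivity))))
    _ = 12 / ρ ^ 2 / n + 12 * η ^ 2 / ε ^ 2 := by
        rw [div_pow, mul_pow, Real.sq_sqrt hn'.le]
        field_simp
    _ < δ := by linarith [hN n ((le_max_left N 1).trans hn)]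

/-- The **delta method** for the proportions of agreeing parities. -/
theorem CircuitRuns.asymptoticallyNormal [IsProbabilityMeasure P] (h : CircuitRuns P q ξ)
    {f : EuclideanSpace ℝ (Fin 3) → ℝ} (hf : DifferentiableAt ℝ f q) :
    AsymptoticallyNormal P (fun n ω => f (proportion ξ n ω)) (f q)
      (deltaVariance f q (covMatrix P ξ)) := by
  refine ⟨by rw [deltaVariance, ← h.variance_linear]; exact variance_nonneg _ _, ?_⟩
  -- Slutsky's argument: the limit law of the linear term passes to `f`, because their difference is
  -- the rescaled Taylor remainder.
  refine tendstoInDistribution_of_tendstoInMeasure_sub _ _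
    (h.tendstoInDistribution_linear (gradient f q).ofLp) ?_
    fun n => ((h.measurable_comp_proportion f n).sub_const _).const_mul _ |>.aemeasurable
  have hR := hasGradientAt_iff_isLittleO.1 hf.hasGradientAt
  convert! h.tendstoInMeasure_of_isLittleO hR using 1
  ext n ω
  simp only [Pi.sub_apply]
  rw [← mul_sub, PiLp.inner_apply]
  simp [mul_comm]

/-- The gradient depends only on the germ at `q`; this transfers the variance from `reconstructA` to
the explicit map. -/
lemma deltaVariance_congr {f₁ f₂ : EuclideanSpace ℝ (Fin 3) → ℝ} (h : f₁ =ᶠ[𝓝 q] f₂)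
    (S : Matrix (Fin 3) (Fin 3) ℝ) : deltaVariance f₁ q S = deltaVariance f₂ q S := by
  simp only [deltaVariance, gradient, h.fderiv_eq]

end BellPair

theorem theorem2 {Ω : Type*} [MeasurableSpace Ω] (P : Measure Ω) [IsProbabilityMeasure P]
    (ξ : ℕ → Ω → Fin 3 → Bool) (a b c d : ℝ)
    (ha : 0 ≤ a) (hb : 0 ≤ b) (hc : 0 ≤ c) (hd : 0 ≤ d) (hsum : a + b + c + d = 1)
    (hab : 1 / 2 < a + b) (had : 1 / 2 < a + d) :
    -- depolarizing parameter 0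
    (CircuitRuns P (agreeProb 0 a b c d) ξ →
      ContDiffOn ℝ (⊤ : ℕ∞) g U ∧ ContDiffOn ℝ (⊤ : ℕ∞) gRounded U ∧ agreeProb 0 a b c d ∈ U ∧
      (∀ x ∈ U, reconstructA 0 x = g x) ∧
      AsymptoticallyNormal P (fun n ω => reconstructA 0 (proportion ξ n ω)) a
        (deltaVariance g (agreeProb 0 a b c d) (covMatrix P ξ)) ∧
      AsymptoticallyNormal P (fun n ω => g (proportion ξ n ω)) a
        (deltaVariance g (agreeProb 0 a b c d) (covMatrix P ξ)) ∧
      AsymptoticallyNormal P (fun n ω => gRounded (proportion ξ n ω))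
        (gRounded (agreeProb 0 a b c d))
        (deltaVariance gRounded (agreeProb 0 a b c d) (covMatrix P ξ))) ∧
    -- depolarizing parameter 0.1
    (CircuitRuns P (agreeProb (1 / 10) a b c d) ξ →
      ContDiffOn ℝ (⊤ : ℕ∞) g' U ∧ ContDiffOn ℝ (⊤ : ℕ∞) gRounded' U ∧ agreeProb (1 / 10) a b c d ∈ U ∧
      (∀ x ∈ U, reconstructA (1 / 10) x = g' x) ∧
      AsymptoticallyNormal P (fun n ω => reconstructA (1 / 10) (proportion ξ n ω)) a
        (deltaVariance g' (agreeProb (1 / 10) a b c d) (covMatrix P ξ)) ∧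
      AsymptoticallyNormal P (fun n ω => g' (proportion ξ n ω)) a
        (deltaVariance g' (agreeProb (1 / 10) a b c d) (covMatrix P ξ)) ∧
      AsymptoticallyNormal P (fun n ω => gRounded' (proportion ξ n ω))
        (gRounded' (agreeProb (1 / 10) a b c d))
        (deltaVariance gRounded' (agreeProb (1 / 10) a b c d) (covMatrix P ξ))) := by 
  have hlam : (1 / 10 : ℝ) < 1 := by norm_num
  have hnhds : ∀ {x : EuclideanSpace ℝ (Fin 3)}, x ∈ U → U ∈ 𝓝 x := isOpen_U.mem_nhds
  have hdiff : ∀ {h : EuclideanSpace ℝ (Fin 3) → ℝ} {x}, ContDiffOn ℝ (⊤ : ℕ∞) h U → x ∈ U →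
      DifferentiableAt ℝ h x := fun hh hx =>
    (hh.contDiffAt (hnhds hx)).differentiableAt (by simp)
  -- The true coefficients solve the system for their own probability vector, so uniqueness returns
  -- `a`.
  have hrec : ∀ lam : ℝ, lam < 1 → reconstructA lam (agreeProb lam a b c d) = a := fun lam hl => by
    have hmem := agreeProb_mem_U hl hsum hab had
    rw [reconstructA_eq_solveA hl hmem]
    exact (IsReconstruction.eq_solveA hl hmem ⟨rfl, hsum, hab.le, had.le⟩).symm
  have main : ∀ (lam : ℝ) (h hR : EuclideanSpace ℝ (Fin 3) → ℝ), lam < 1 →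
      ContDiffOn ℝ (⊤ : ℕ∞) h U → ContDiffOn ℝ (⊤ : ℕ∞) hR U →
      (∀ x ∈ U, reconstructA lam x = h x) → CircuitRuns P (agreeProb lam a b c d) ξ →
      ContDiffOn ℝ (⊤ : ℕ∞) h U ∧ ContDiffOn ℝ (⊤ : ℕ∞) hR U ∧ agreeProb lam a b c d ∈ U ∧
      (∀ x ∈ U, reconstructA lam x = h x) ∧
      AsymptoticallyNormal P (fun n ω => reconstructA lam (proportion ξ n ω)) a
        (deltaVariance h (agreeProb lam a b c d) (covMatrix P ξ)) ∧
      AsymptoticallyNormal P (fun n ω => h (proportion ξ n ω)) a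
        (deltaVariance h (agreeProb lam a b c d) (covMatrix P ξ)) ∧
      AsymptoticallyNormal P (fun n ω => hR (proportion ξ n ω)) (hR (agreeProb lam a b c d))
        (deltaVariance hR (agreeProb lam a b c d) (covMatrix P ξ)) := by
    intro lam h hR hl hh hhR heq hruns
    have hmem := agreeProb_mem_U hl hsum hab had
    -- Values of the estimator outside `U` do not matter: the delta method sees only its germ at the
    -- true vector.
    have hev : reconstructA lam =ᶠ[𝓝 (agreeProb lam a b c d)] h :=
      Filter.mem_of_superset (hnhds hmem) heq
    have h1 := hruns.asymptoticallyNormal ((hdiff hh hmem).congr_of_eventuallyEq hev)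
    have h2 := hruns.asymptoticallyNormal (hdiff hh hmem)
    rw [deltaVariance_congr hev, hrec lam hl] at h1
    rw [← heq _ hmem, hrec lam hl] at h2
    exact ⟨hh, hhR, hmem, heq, h1, h2, hruns.asymptoticallyNormal (hdiff hhR hmem)⟩
  refine ⟨main 0 g gRounded one_pos contDiffOn_g contDiffOn_gRounded fun x hx => ?_,
    main (1 / 10) g' gRounded' hlam contDiffOn_g' contDiffOn_gRounded' fun x hx => ?_⟩
  · rw [reconstructA_eq_solveA one_pos hx, g_eq_solveA hx, sub_zero]
  · rw [reconstructA_eq_solveA hlam hx, g'_eq_solveA hx]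
    norm_num
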